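/- Let $\mathfrak A$ and $\mathfrak B$ be Banach algebras (real or complex, not necessarily unital). A Banach $\mathfrak A$-bimodule is a Banach space $X$ with commuting, jointly bounded left and right actions of $\mathfrak A$; its dual $X^*$ is a Banach $\mathfrak A$-bimodule via $\langle x,a.\varphi\rangle=\langle x.a,\varphi\rangle$ and $\langle x,\varphi.a\rangle=\langle a.x,\varphi\rangle$. A derivation $D\colon\mathfrak A\to X$ is a bounded linear map with $D(ab)=a.D(b)+D(a).b$. It is approximately inner if there is a net $(x_\gamma)$ in $X$ with $D(a)=\lim_\gamma(a.x_\gamma-x_\gamma.a)$ in norm for every $a\in\mathfrak A$. A Banach algebra is approximately amenable if, for all Banach bimodules $X$ over it, every derivation from it into $X^*$ is approximately inner. $\mathfrak B$ is an envelope of $\mathfrak A$ if $\mathfrak A$ is a two-sided ideal in $\mathfrak B$ with bounded inclusion and there is $C>0$ with $\max\{\|ba\|_{\mathfrak A},\|ab\|_{\mathfrak A}\}\le C\|a\|_{\mathfrak A}\|b\|_{\mathfrak B}$ for all $a\in\mathfrak A$, $b\in\mathfrak B$. A Banach $\mathfrak A$-bimodule $X$ is $\mathfrak A$-induced if exterior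 multiplication $a\otimes x\otimes c\mapsto a.x.c$ induces a (topological) bimodule isomorphism $\mathfrak A\widehat\otimes_{\mathfrak A}X\widehat\otimes_{\mathfrak A}\mathfrak A\to X$, where $\widehat\otimes_{\mathfrak A}$ is the $\mathfrak A$-balanced projective tensor product. **Theorem 2.3.** Let $\mathfrak A$ have an approximately amenable envelope $\mathfrak B$. If $X$ is an $\mathfrak A$-induced Banach $\mathfrak A$-bimodule, then every derivation $D\colon\mathfrak A\to X^*$ is approximately inner. In particular, if $\mathfrak A$ has a bounded (two-sided) approximate identity, then $\mathfrak A$ is approximately amenable. -/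

import Mathlib

open scoped TensorProduct Topology

noncomputable section

/-! ### The projective tensor product of two normed spaces -/

section ProjectiveTensor

variable (𝕜 : Type*) [RCLike 𝕜]
variable (E : Type*) [NormedAddCommGroup E] [NormedSpace 𝕜 E]
variable (F : Type*) [NormedAddCommGroup F] [NormedSpace 𝕜 F]
variable {G : Type*} [NormedAddCommGroup G] [NormedSpace 𝕜 G]

/-- The algebraic tensor product `E ⊗ F`, a type copy that carries the projective seminorm. -/
def AlgTensor : Type _ := E ⊗[𝕜] F

namespace AlgTensor

instance : AddCommGroup (AlgTensor 𝕜 E F) := inferInstanceAs (AddCommGroup (E ⊗[𝕜] F))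

instance : Module 𝕜 (AlgTensor 𝕜 E F) := inferInstanceAs (Module 𝕜 (E ⊗[𝕜] F))

variable {E F}

/-- The elementary tensor `e ⊗ f`. -/
def tmul (e : E) (f : F) : AlgTensor 𝕜 E F := e ⊗ₜ[𝕜] f

/-- The value `∑ ‖eᵢ‖ ‖fᵢ‖` of the formal sum `∑ eᵢ ⊗ fᵢ`. -/
def cost (l : List (E × F)) : ℝ := (l.map fun p => ‖p.1‖ * ‖p.2‖).sum

/-- The tensor represented by a formal sum `∑ eᵢ ⊗ fᵢ`. -/
def ofList (l : List (E × F)) : AlgTensor 𝕜 E F := (l.map fun p => tmul 𝕜 p.1 p.2).sum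

/-- The projective seminorm: the infimum of `∑ ‖eᵢ‖ ‖fᵢ‖` over all finite representations
`u = ∑ eᵢ ⊗ fᵢ`. -/
def projNorm (u : AlgTensor 𝕜 E F) : ℝ := sInf (cost '' {l : List (E × F) | ofList 𝕜 l = u})

theorem cost_nonneg (l : List (E × F)) : 0 ≤ cost l := by
  refine List.sum_nonneg fun r hr => ?_
  obtain ⟨p, -, rfl⟩ := List.mem_map.1 hr
  positivity

theorem cost_append (l m : List (E × F)) : cost (l ++ m) = cost l + cost m := by
  simp [cost]

theorem ofList_append (l m : List (E × F)) :
    ofList 𝕜 (l ++ m) = ofList 𝕜 l + ofList 𝕜 m := by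
  simp [ofList]

theorem exists_ofList (u : AlgTensor 𝕜 E F) : ∃ l : List (E × F), ofList 𝕜 l = u := by
  induction u using TensorProduct.induction_on with
  | zero => exact ⟨[], rfl⟩
  | tmul e f => exact ⟨[(e, f)], by simp [ofList]; rfl⟩
  | add x y hx hy =>
    obtain ⟨l, hl⟩ := hx
    obtain ⟨m, hm⟩ := hy
    exact ⟨l ++ m, by rw [ofList_append, hl, hm]; rfl⟩

theorem projNorm_le (l : List (E × F)) : projNorm 𝕜 (ofList 𝕜 l) ≤ cost l :=
  csInf_le ⟨0, by rintro _ ⟨m, -, rfl⟩; exact cost_nonneg m⟩ ⟨l, rfl, rfl⟩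

theorem le_projNorm {u : AlgTensor 𝕜 E F} {r : ℝ}
    (h : ∀ l : List (E × F), ofList 𝕜 l = u → r ≤ cost l) : r ≤ projNorm 𝕜 u := by
  obtain ⟨l, hl⟩ := exists_ofList 𝕜 u
  refine le_csInf ⟨_, l, hl, rfl⟩ ?_
  rintro _ ⟨m, hm, rfl⟩
  exact h m hm

theorem projNorm_add_le (u v : AlgTensor 𝕜 E F) :
    projNorm 𝕜 (u + v) ≤ projNorm 𝕜 u + projNorm 𝕜 v := by
  rw [← sub_le_iff_le_add]
  refine le_projNorm 𝕜 fun l hl => ?_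
  rw [sub_le_comm]
  refine le_projNorm 𝕜 fun m hm => ?_
  have h := projNorm_le 𝕜 (l ++ m)
  rw [ofList_append, cost_append, hl, hm] at h
  linarith

theorem projNorm_smul_le (c : 𝕜) (u : AlgTensor 𝕜 E F) :
    projNorm 𝕜 (c • u) ≤ ‖c‖ * projNorm 𝕜 u := by
  have key : ∀ l : List (E × F), ofList 𝕜 l = u → projNorm 𝕜 (c • u) ≤ ‖c‖ * cost l := by
    intro l hl
    have h := projNorm_le 𝕜 (l.map fun p => (c • p.1, p.2))
    have h1 : ofList 𝕜 (l.map fun p => (c • p.1, p.2)) = c • u := by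
      rw [← hl]
      simp only [ofList, List.map_map, List.smul_sum]
      rfl
    have h2 : cost (l.map fun p => (c • p.1, p.2)) = ‖c‖ * cost l := by
      simp [cost, Function.comp_def, norm_smul, mul_assoc, List.sum_map_mul_left]
    rwa [h1, h2] at h
  rcases (norm_nonneg c).eq_or_lt with h0 | h0
  · obtain ⟨l, hl⟩ := exists_ofList 𝕜 u
    simpa [← h0] using key l hl
  · rw [← div_le_iff₀' h0]
    exact le_projNorm 𝕜 fun l hl => by
      rw [div_le_iff₀' h0]
      exact key l hl

theorem projNorm_zero : projNorm 𝕜 (0 : AlgTensor 𝕜 E F) = 0 :=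
  le_antisymm (by simpa [ofList, cost] using projNorm_le 𝕜 ([] : List (E × F)))
    (le_projNorm 𝕜 fun l _ => cost_nonneg l)

variable (E F) in
/-- The projective seminorm, bundled. -/
def projSeminorm : Seminorm 𝕜 (AlgTensor 𝕜 E F) :=
  .ofSMulLE (projNorm 𝕜) (projNorm_zero 𝕜) (projNorm_add_le 𝕜) (projNorm_smul_le 𝕜)

instance : SeminormedAddCommGroup (AlgTensor 𝕜 E F) :=
  (projSeminorm 𝕜 E F).toAddGroupSeminorm.toSeminormedAddCommGroup

instance : NormedSpace 𝕜 (AlgTensor 𝕜 E F) := ⟨projNorm_smul_le 𝕜⟩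

theorem norm_def (u : AlgTensor 𝕜 E F) : ‖u‖ = projNorm 𝕜 u := rfl

theorem norm_tmul_le (e : E) (f : F) : ‖tmul 𝕜 e f‖ ≤ 1 * ‖e‖ * ‖f‖ := by
  simpa [ofList, cost, ← norm_def] using projNorm_le 𝕜 [(e, f)]

/-- The linear map on `E ⊗ F` given by a bounded bilinear map. -/
def liftLin (φ : E →L[𝕜] F →L[𝕜] G) : AlgTensor 𝕜 E F →ₗ[𝕜] G :=
  TensorProduct.lift ((ContinuousLinearMap.coeLM 𝕜).comp φ.toLinearMap)

theorem liftLin_tmul (φ : E →L[𝕜] F →L[𝕜] G) (e : E) (f : F) :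
    liftLin 𝕜 φ (tmul 𝕜 e f) = φ e f :=
  TensorProduct.lift.tmul (f' := (ContinuousLinearMap.coeLM 𝕜).comp φ.toLinearMap) e f

theorem norm_liftLin_ofList_le (φ : E →L[𝕜] F →L[𝕜] G) (l : List (E × F)) :
    ‖liftLin 𝕜 φ (ofList 𝕜 l)‖ ≤ ‖φ‖ * cost l := by
  induction l with
  | nil => simp [ofList, cost]
  | cons p l ih =>
    have h1 : ofList 𝕜 (p :: l) = tmul 𝕜 p.1 p.2 + ofList 𝕜 l := by simp [ofList]
    have h2 : cost (p :: l) = ‖p.1‖ * ‖p.2‖ + cost l := by simp [cost]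
    rw [h1, h2, map_add, mul_add, liftLin_tmul]
    refine (norm_add_le _ _).trans (add_le_add ?_ ih)
    simpa [mul_assoc] using φ.le_opNorm₂ p.1 p.2

theorem norm_liftLin_le (φ : E →L[𝕜] F →L[𝕜] G) (u : AlgTensor 𝕜 E F) :
    ‖liftLin 𝕜 φ u‖ ≤ ‖φ‖ * ‖u‖ := by
  rcases (norm_nonneg φ).eq_or_lt with h0 | h0
  · obtain ⟨l, rfl⟩ := exists_ofList 𝕜 u
    have h := norm_liftLin_ofList_le 𝕜 φ l
    rwa [← h0, zero_mul] at h ⊢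
  · rw [← div_le_iff₀' h0]
    refine le_projNorm 𝕜 fun l hl => ?_
    rw [div_le_iff₀' h0, ← hl]
    exact norm_liftLin_ofList_le 𝕜 φ l

/-- The bounded linear map on `E ⊗ F` given by a bounded bilinear map. -/
def lift (φ : E →L[𝕜] F →L[𝕜] G) : AlgTensor 𝕜 E F →L[𝕜] G :=
  (liftLin 𝕜 φ).mkContinuous ‖φ‖ (norm_liftLin_le 𝕜 φ)

theorem lift_tmul (φ : E →L[𝕜] F →L[𝕜] G) (e : E) (f : F) :
    lift 𝕜 φ (tmul 𝕜 e f) = φ e f :=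
  liftLin_tmul 𝕜 φ e f

end AlgTensor

/-- The (completed) projective tensor product `E ⊗̂ F`. -/
def ProjTensor : Type _ := UniformSpace.Completion (AlgTensor 𝕜 E F)

namespace ProjTensor

instance : NormedAddCommGroup (ProjTensor 𝕜 E F) :=
  inferInstanceAs (NormedAddCommGroup (UniformSpace.Completion (AlgTensor 𝕜 E F)))

instance : NormedSpace 𝕜 (ProjTensor 𝕜 E F) :=
  inferInstanceAs (NormedSpace 𝕜 (UniformSpace.Completion (AlgTensor 𝕜 E F)))

instance : CompleteSpace (ProjTensor 𝕜 E F) :=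
  inferInstanceAs (CompleteSpace (UniformSpace.Completion (AlgTensor 𝕜 E F)))

/-- The canonical map `E ⊗ F → E ⊗̂ F`. -/
def coeL : AlgTensor 𝕜 E F →L[𝕜] ProjTensor 𝕜 E F :=
  UniformSpace.Completion.toComplL

variable {E F}

/-- The elementary tensor `e ⊗ f` in `E ⊗̂ F`, as a bounded bilinear map. -/
def tmul : E →L[𝕜] F →L[𝕜] ProjTensor 𝕜 E F :=
  LinearMap.mkContinuous₂
    (LinearMap.mk₂ 𝕜 (fun e f => coeL 𝕜 E F (AlgTensor.tmul 𝕜 e f))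
      (fun e e' f => by
        rw [← map_add]; exact congrArg (coeL 𝕜 E F) (TensorProduct.add_tmul e e' f))
      (fun c e f => by rw [← map_smul]; rfl)
      (fun e f f' => by
        rw [← map_add]; exact congrArg (coeL 𝕜 E F) (TensorProduct.tmul_add e f f'))
      (fun c e f => by
        rw [← map_smul]; exact congrArg (coeL 𝕜 E F) (TensorProduct.tmul_smul c e f)))
    1 (fun e f =>
      (UniformSpace.Completion.norm_coe (AlgTensor.tmul 𝕜 e f)).le.trans
        (AlgTensor.norm_tmul_le 𝕜 e f))

theorem tmul_apply (e : E) (f : F) :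
    tmul 𝕜 e f = coeL 𝕜 E F (AlgTensor.tmul 𝕜 e f) := rfl

/-- Bounded linear maps on `E ⊗̂ F` that agree on elementary tensors are equal. -/
theorem hom_ext {T : ProjTensor 𝕜 E F →L[𝕜] G} {S : ProjTensor 𝕜 E F →L[𝕜] G}
    (h : ∀ e f, T (tmul 𝕜 e f) = S (tmul 𝕜 e f)) : T = S := by
  have key : ∀ u : AlgTensor 𝕜 E F, T (coeL 𝕜 E F u) = S (coeL 𝕜 E F u) := by
    intro u
    induction u using TensorProduct.induction_on with
    | zero => exact (map_zero (T.comp (coeL 𝕜 E F))).trans (map_zero (S.comp (coeL 𝕜 E F))).symm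
    | tmul e f => exact h e f
    | add x y hx hy =>
      exact (map_add (T.comp (coeL 𝕜 E F)) x y).trans
        ((congrArg₂ (· + ·) hx hy).trans (map_add (S.comp (coeL 𝕜 E F)) x y).symm)
  refine DFunLike.coe_injective ?_
  exact DenseRange.equalizer (UniformSpace.Completion.denseRange_coe (α := AlgTensor 𝕜 E F))
    T.continuous S.continuous (funext key)

/-- The bounded linear map on `E ⊗̂ F` given by a bounded bilinear map into a Banach space. -/
def lift [CompleteSpace G] (φ : E →L[𝕜] F →L[𝕜] G) : ProjTensor 𝕜 E F →L[𝕜] G :=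
  (AlgTensor.lift 𝕜 φ).extend (coeL 𝕜 E F)

theorem lift_tmul [CompleteSpace G] (φ : E →L[𝕜] F →L[𝕜] G) (e : E) (f : F) :
    lift 𝕜 φ (tmul 𝕜 e f) = φ e f := by
  rw [← AlgTensor.lift_tmul 𝕜 φ e f]
  exact ContinuousLinearMap.extend_eq (e := coeL 𝕜 E F) (AlgTensor.lift 𝕜 φ)
    (UniformSpace.Completion.denseRange_coe (α := AlgTensor 𝕜 E F))
    (UniformSpace.Completion.isUniformInducing_coe (AlgTensor 𝕜 E F)) _

end ProjTensor

end ProjectiveTensor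

/-! ### The balanced projective tensor product -/

section Balanced

variable {𝕜 : Type*} [RCLike 𝕜]
variable {A : Type*} [NonUnitalNormedRing A] [NormedSpace 𝕜 A]
variable {E : Type*} [NormedAddCommGroup E] [NormedSpace 𝕜 E]
variable {F : Type*} [NormedAddCommGroup F] [NormedSpace 𝕜 F]
variable {G : Type*} [NormedAddCommGroup G] [NormedSpace 𝕜 G] [CompleteSpace G]

/-- The closed linear span in `E ⊗̂ F` of the tensors `e.a ⊗ f - e ⊗ a.f`, where `e.a = r a e` is a
bounded right action of `A` on `E` and `a.f = l a f` is a bounded left action of `A` on `F`. -/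
def balancingSubmodule (r : A →L[𝕜] E →L[𝕜] E) (l : A →L[𝕜] F →L[𝕜] F) :
    Submodule 𝕜 (ProjTensor 𝕜 E F) :=
  (Submodule.span 𝕜 {u | ∃ (e : E) (a : A) (f : F),
    u = ProjTensor.tmul 𝕜 (r a e) f - ProjTensor.tmul 𝕜 e (l a f)}).topologicalClosure

instance (r : A →L[𝕜] E →L[𝕜] E) (l : A →L[𝕜] F →L[𝕜] F) :
    IsClosed (balancingSubmodule r l : Set (ProjTensor 𝕜 E F)) :=
  Submodule.isClosed_topologicalClosure _

/-- The `A`-balanced projective tensor product `E ⊗̂_A F`: the quotient of `E ⊗̂ F` by the closed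
linear span of all `e.a ⊗ f - e ⊗ a.f`, with the quotient norm. -/
def BalancedTensor (r : A →L[𝕜] E →L[𝕜] E) (l : A →L[𝕜] F →L[𝕜] F) : Type _ :=
  ProjTensor 𝕜 E F ⧸ balancingSubmodule r l

namespace BalancedTensor

variable (r : A →L[𝕜] E →L[𝕜] E) (l : A →L[𝕜] F →L[𝕜] F)

instance : NormedAddCommGroup (BalancedTensor r l) :=
  inferInstanceAs (NormedAddCommGroup (ProjTensor 𝕜 E F ⧸ balancingSubmodule r l))

instance : NormedSpace 𝕜 (BalancedTensor r l) :=
  inferInstanceAs (NormedSpace 𝕜 (ProjTensor 𝕜 E F ⧸ balancingSubmodule r l))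

instance : CompleteSpace (BalancedTensor r l) :=
  inferInstanceAs (CompleteSpace (ProjTensor 𝕜 E F ⧸ balancingSubmodule r l))

/-- The quotient map `E ⊗̂ F → E ⊗̂_A F`. -/
def mk : ProjTensor 𝕜 E F →L[𝕜] BalancedTensor r l :=
  (balancingSubmodule r l).mkQL

/-- The elementary tensor `e ⊗ f` in `E ⊗̂_A F`, as a bounded bilinear map. -/
def tmul : E →L[𝕜] F →L[𝕜] BalancedTensor r l :=
  (ContinuousLinearMap.compL 𝕜 F (ProjTensor 𝕜 E F) (BalancedTensor r l)
    (mk r l)).comp (ProjTensor.tmul 𝕜)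

theorem tmul_balanced (e : E) (a : A) (f : F) :
    tmul r l (r a e) f = tmul r l e (l a f) :=
  (Submodule.Quotient.eq _).2
    (Submodule.le_topologicalClosure _ (Submodule.subset_span ⟨e, a, f, rfl⟩))

variable {r l}

/-- Bounded linear maps on `E ⊗̂_A F` that agree on elementary tensors are equal. -/
theorem hom_ext {H : Type*} [NormedAddCommGroup H] [NormedSpace 𝕜 H]
    {T S : BalancedTensor r l →L[𝕜] H}
    (h : ∀ e f, T (tmul r l e f) = S (tmul r l e f)) : T = S := by
  have : T.comp (mk r l) = S.comp (mk r l) :=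
    ProjTensor.hom_ext 𝕜 h
  ext u
  obtain ⟨v, rfl⟩ := Submodule.Quotient.mk_surjective _ u
  exact DFunLike.congr_fun this v

/-- The bounded linear map on `E ⊗̂_A F` given by a bounded `A`-balanced bilinear map. -/
def lift (φ : E →L[𝕜] F →L[𝕜] G) (h : ∀ e a f, φ (r a e) f = φ e (l a f)) :
    BalancedTensor r l →L[𝕜] G where
  toLinearMap := (balancingSubmodule r l).liftQ (ProjTensor.lift 𝕜 φ).toLinearMap (by
    refine Submodule.topologicalClosure_minimal _ (Submodule.span_le.2 ?_)
      (ProjTensor.lift 𝕜 φ).isClosed_ker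
    rintro _ ⟨e, a, f, rfl⟩
    change ProjTensor.lift 𝕜 φ _ = 0
    rw [map_sub, ProjTensor.lift_tmul, ProjTensor.lift_tmul, h, sub_self])
  cont := (ProjTensor.lift 𝕜 φ).continuous.quotient_lift _

theorem lift_tmul (φ : E →L[𝕜] F →L[𝕜] G) (h : ∀ e a f, φ (r a e) f = φ e (l a f))
    (e : E) (f : F) : lift φ h (tmul r l e f) = φ e f :=
  ProjTensor.lift_tmul 𝕜 φ e f

end BalancedTensor

end Balanced

/-! ### Banach bimodules, derivations and approximate amenability -/

section Bimodules

/-- The structure of a Banach `A`-bimodule on a Banach space `X`: commuting left and right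
actions `a.x = M.left a x` and `x.a = M.right a x`, linear and bounded in both variables
(`‖a.x‖ ≤ C ‖a‖ ‖x‖` and `‖x.a‖ ≤ C ‖a‖ ‖x‖` for some constant `C`). -/
structure BanachBimodule (𝕜 : Type*) [RCLike 𝕜]
    (A : Type*) [NonUnitalNormedRing A] [NormedSpace 𝕜 A]
    (X : Type*) [NormedAddCommGroup X] [NormedSpace 𝕜 X] where
  /-- The left action, `left a x = a.x`. -/
  left : A →L[𝕜] X →L[𝕜] X
  /-- The right action, `right a x = x.a`. -/
  right : A →L[𝕜] X →L[𝕜] X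
  left_mul : ∀ (a b : A) (x : X), left (a * b) x = left a (left b x)
  right_mul : ∀ (a b : A) (x : X), right (a * b) x = right b (right a x)
  left_right : ∀ (a b : A) (x : X), left a (right b x) = right b (left a x)

variable {𝕜 : Type*} [RCLike 𝕜]
variable {A : Type*} [NonUnitalNormedRing A] [NormedSpace 𝕜 A]
variable {X : Type*} [NormedAddCommGroup X] [NormedSpace 𝕜 X]

/-- A derivation from `A` into a Banach `A`-bimodule: a bounded linear map with
`D (a b) = a.D(b) + D(a).b`. -/
def IsModuleDerivation (M : BanachBimodule 𝕜 A X) (D : A →L[𝕜] X) : Prop :=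
  ∀ a b : A, D (a * b) = M.left a (D b) + M.right b (D a)

/-- The inner derivation `a ↦ a.x - x.a`. -/
def innerDerivation (M : BanachBimodule 𝕜 A X) (x : X) : A →L[𝕜] X :=
  M.left.flip x - M.right.flip x

/-- `D` is approximately inner: it lies in the closure of the set of inner derivations in the
strong operator topology (the topology of pointwise norm convergence). -/
def IsApproximatelyInner (M : BanachBimodule 𝕜 A X) (D : A →L[𝕜] X) : Prop :=
  (D : A → X) ∈ closure (Set.range fun x : X => (innerDerivation M x : A → X))

/-- The dual bimodule `X*` of a Banach bimodule `X`: `(a.φ)(x) = φ(x.a)`, `(φ.a)(x) = φ(a.x)`. -/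
def BanachBimodule.dual (M : BanachBimodule 𝕜 A X) : BanachBimodule 𝕜 A (StrongDual 𝕜 X) where
  left := ((ContinuousLinearMap.compL 𝕜 X X 𝕜).flip).comp M.right
  right := ((ContinuousLinearMap.compL 𝕜 X X 𝕜).flip).comp M.left
  left_mul a b φ := by ext x; exact congrArg φ (M.right_mul a b x)
  right_mul a b φ := by ext x; exact congrArg φ (M.left_mul a b x)
  left_right a b φ := by ext x; exact congrArg φ (M.left_right b a x)

/-- The Banach algebra `A` is approximately amenable: for every Banach `A`-bimodule `X`, every
derivation `A → X*` is approximately inner. The universe of the modules `X` is a parameter. -/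
def ApproximatelyAmenable.{w, u, v} (𝕜 : Type u) [RCLike 𝕜]
    (A : Type v) [NonUnitalNormedRing A] [NormedSpace 𝕜 A] : Prop :=
  ∀ (X : Type w) [NormedAddCommGroup X] [NormedSpace 𝕜 X] [CompleteSpace X]
    (M : BanachBimodule 𝕜 A X) (D : A →L[𝕜] StrongDual 𝕜 X),
    IsModuleDerivation M.dual D → IsApproximatelyInner M.dual D

/-- `A` has a bounded (two-sided) approximate identity. -/
def HasBAI (A : Type*) [NonUnitalNormedRing A] : Prop :=
  ∃ l : Filter A, l.IsApproximateUnit ∧ ∃ C : ℝ, ∀ᶠ e in l, ‖e‖ ≤ C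

end Bimodules

/-! ### Induced bimodules -/

section Induced

variable {𝕜 : Type*} [RCLike 𝕜]
variable {A : Type*} [NonUnitalNormedRing A] [NormedSpace 𝕜 A]
  [IsScalarTower 𝕜 A A] [SMulCommClass 𝕜 A A]
variable {X : Type*} [NormedAddCommGroup X] [NormedSpace 𝕜 X]

/-- `A` as a Banach bimodule over itself, by multiplication. -/
def selfBimodule (𝕜 : Type*) [RCLike 𝕜] (A : Type*) [NonUnitalNormedRing A] [NormedSpace 𝕜 A]
    [IsScalarTower 𝕜 A A] [SMulCommClass 𝕜 A A] : BanachBimodule 𝕜 A A where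
  left := ContinuousLinearMap.mul 𝕜 A
  right := (ContinuousLinearMap.mul 𝕜 A).flip
  left_mul a b x := mul_assoc a b x
  right_mul a b x := (mul_assoc x a b).symm
  left_right a b x := (mul_assoc a x b).symm

namespace BanachBimodule

variable (M : BanachBimodule 𝕜 A X)

/-- The Banach space `A ⊗̂_A X`. -/
abbrev LeftTensor : Type _ := BalancedTensor (selfBimodule 𝕜 A).right M.left

/-- The bounded bilinear map `(c, x) ↦ (a ↦ c ⊗ x.a)`. -/
def tensorRightBilin : A →L[𝕜] X →L[𝕜] A →L[𝕜] M.LeftTensor :=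
  ((ContinuousLinearMap.compL 𝕜 X (A →L[𝕜] X) (A →L[𝕜] M.LeftTensor)).flip M.right.flip).comp
    ((ContinuousLinearMap.compL 𝕜 A X M.LeftTensor).comp
      (BalancedTensor.tmul (selfBimodule 𝕜 A).right M.left))

theorem tensorRightBilin_apply (c : A) (x : X) (a : A) :
    M.tensorRightBilin c x a =
      BalancedTensor.tmul (selfBimodule 𝕜 A).right M.left c (M.right a x) := rfl

/-- The right action of `A` on `A ⊗̂_A X`, with `(c ⊗ x).a = c ⊗ x.a`. -/
def leftTensorRight : A →L[𝕜] M.LeftTensor →L[𝕜] M.LeftTensor :=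
  (BalancedTensor.lift (r := (selfBimodule 𝕜 A).right) (l := M.left) M.tensorRightBilin
    (fun c b x => by
      ext a
      rw [tensorRightBilin_apply, tensorRightBilin_apply, BalancedTensor.tmul_balanced,
        M.left_right])).flip

theorem leftTensorRight_tmul (a c : A) (x : X) :
    M.leftTensorRight a (BalancedTensor.tmul (selfBimodule 𝕜 A).right M.left c x) =
      BalancedTensor.tmul (selfBimodule 𝕜 A).right M.left c (M.right a x) :=
  DFunLike.congr_fun (BalancedTensor.lift_tmul M.tensorRightBilin _ c x) a

/-- The Banach space `(A ⊗̂_A X) ⊗̂_A A`. -/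
abbrev TripleTensor : Type _ := BalancedTensor M.leftTensorRight (selfBimodule 𝕜 A).left

/-- The elementary tensor `a ⊗ x ⊗ b` in `A ⊗̂_A X ⊗̂_A A`. -/
def triple (a : A) (x : X) (b : A) : M.TripleTensor :=
  BalancedTensor.tmul M.leftTensorRight (selfBimodule 𝕜 A).left
    (BalancedTensor.tmul (selfBimodule 𝕜 A).right M.left a x) b

variable [CompleteSpace X]

/-- The map `A ⊗̂_A X → X`, `a ⊗ x ↦ a.x`. -/
def leftMultiplication : M.LeftTensor →L[𝕜] X :=
  BalancedTensor.lift M.left (fun c b x => M.left_mul c b x)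

theorem leftMultiplication_tmul (a : A) (x : X) :
    M.leftMultiplication (BalancedTensor.tmul (selfBimodule 𝕜 A).right M.left a x) =
      M.left a x :=
  BalancedTensor.lift_tmul _ _ a x

theorem leftMultiplication_right (a : A) (p : M.LeftTensor) :
    M.leftMultiplication (M.leftTensorRight a p) = M.right a (M.leftMultiplication p) := by
  have : M.leftMultiplication.comp (M.leftTensorRight a) =
      (M.right a).comp M.leftMultiplication :=
    BalancedTensor.hom_ext fun c x => by
      simp only [ContinuousLinearMap.comp_apply]
      rw [leftTensorRight_tmul, leftMultiplication_tmul, leftMultiplication_tmul, M.left_right]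
  exact DFunLike.congr_fun this p

/-- Exterior multiplication `A ⊗̂_A X ⊗̂_A A → X`, `a ⊗ x ⊗ b ↦ a.x.b`. -/
def exteriorMultiplication : M.TripleTensor →L[𝕜] X :=
  BalancedTensor.lift (M.right.flip.comp M.leftMultiplication) (fun p a b => by
    change M.right b (M.leftMultiplication (M.leftTensorRight a p)) =
      M.right (a * b) (M.leftMultiplication p)
    rw [leftMultiplication_right, M.right_mul])

theorem exteriorMultiplication_triple (a : A) (x : X) (b : A) :
    M.exteriorMultiplication (M.triple a x b) = M.right b (M.left a x) := by
  refine (BalancedTensor.lift_tmul _ _ _ b).trans ?_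
  change M.right b (M.leftMultiplication _) = _
  rw [leftMultiplication_tmul]

/-- The Banach bimodule `X` is induced: exterior multiplication `A ⊗̂_A X ⊗̂_A A → X` is an
isomorphism (a linear homeomorphism). It respects the outer actions of `A` on
`A ⊗̂_A X ⊗̂_A A`, because `(ca).x.(bd) = c.(a.x.b).d`, so it is then a bimodule isomorphism. -/
def IsInduced : Prop :=
  ∃ e : M.TripleTensor ≃L[𝕜] X, ∀ u, e u = M.exteriorMultiplication u

end BanachBimodule

end Induced

/-! ### Envelopes -/

section Envelope

/-- The Banach algebra `B` is an envelope of the Banach algebra `A` along `ι : A → B`: `ι` is a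
bounded injective algebra homomorphism whose image is a two-sided ideal of `B`, and, for some
`C > 0`, the products `ba` and `ab` (taken in `B`, regarded as elements of `A`) have `A`-norm at
most `C ‖a‖ ‖b‖`. -/
structure IsEnvelope {𝕜 : Type*} [RCLike 𝕜]
    {A : Type*} [NonUnitalNormedRing A] [NormedSpace 𝕜 A]
    {B : Type*} [NonUnitalNormedRing B] [NormedSpace 𝕜 B]
    (ι : A →ₙₐ[𝕜] B) : Prop where
  injective : Function.Injective ι
  continuous : Continuous ι
  ideal_left : ∀ (b : B) (a : A), ∃ c : A, ι c = b * ι a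
  ideal_right : ∀ (a : A) (b : B), ∃ c : A, ι c = ι a * b
  bound : ∃ C : ℝ, 0 < C ∧ ∀ (a : A) (b : B) (c : A),
    ι c = b * ι a ∨ ι c = ι a * b → ‖c‖ ≤ C * ‖a‖ * ‖b‖

end Envelope

end

universe w u v t

noncomputable section

/-! ### Universal property of triple tensors and induced bimodules -/

section Universal

variable {𝕜 : Type*} [RCLike 𝕜]
variable {A : Type*} [NonUnitalNormedRing A] [NormedSpace 𝕜 A]
  [IsScalarTower 𝕜 A A] [SMulCommClass 𝕜 A A]
variable {X : Type*} [NormedAddCommGroup X] [NormedSpace 𝕜 X]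
variable {G : Type*} [NormedAddCommGroup G] [NormedSpace 𝕜 G]

namespace BanachBimodule

/-- Bounded linear maps on `A ⊗̂_A X ⊗̂_A A` that agree on elementary tensors are equal. -/
theorem triple_hom_ext {M : BanachBimodule 𝕜 A X} {S T : M.TripleTensor →L[𝕜] G}
    (h : ∀ a x c, S (M.triple a x c) = T (M.triple a x c)) : S = T := by
  refine BalancedTensor.hom_ext fun p c => ?_
  let τ := (BalancedTensor.tmul M.leftTensorRight (selfBimodule 𝕜 A).left).flip c
  have : S.comp τ = T.comp τ := BalancedTensor.hom_ext fun a x => h a x c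
  exact DFunLike.congr_fun this p

/-- The bounded linear map on `A ⊗̂_A X ⊗̂_A A` given by a balanced bounded trilinear map. -/
theorem exists_triple_lift [CompleteSpace G] (M : BanachBimodule 𝕜 A X)
    (φ : A →L[𝕜] X →L[𝕜] A →L[𝕜] G)
    (h₁ : ∀ a b x c, φ (a * b) x c = φ a (M.left b x) c)
    (h₂ : ∀ a x b c, φ a (M.right b x) c = φ a x (b * c)) :
    ∃ T : M.TripleTensor →L[𝕜] G, ∀ a x c, T (M.triple a x c) = φ a x c := by
  let φ' : M.LeftTensor →L[𝕜] A →L[𝕜] G :=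
    BalancedTensor.lift φ fun a b x => by ext c; exact h₁ a b x c
  have hφ' : ∀ a x, φ' (BalancedTensor.tmul (selfBimodule 𝕜 A).right M.left a x) = φ a x :=
    fun a x => BalancedTensor.lift_tmul _ _ a x
  refine ⟨BalancedTensor.lift φ' fun p b c => ?_, fun a x c => ?_⟩
  · have : (φ'.flip c).comp (M.leftTensorRight b) = φ'.flip (b * c) :=
      BalancedTensor.hom_ext fun a x => by
        simp only [ContinuousLinearMap.comp_apply, ContinuousLinearMap.flip_apply]
        rw [leftTensorRight_tmul, hφ', hφ', h₂]
    exact DFunLike.congr_fun this p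
  · exact (BalancedTensor.lift_tmul _ _ _ c).trans (by rw [hφ'])

variable [CompleteSpace X] {M : BanachBimodule 𝕜 A X}

/-- Bounded linear maps on an induced bimodule that agree on the products `a.x.c` are equal. -/
theorem IsInduced.hom_ext (hM : M.IsInduced) {S T : X →L[𝕜] G}
    (h : ∀ a x c, S (M.right c (M.left a x)) = T (M.right c (M.left a x))) : S = T := by
  obtain ⟨e, he⟩ := hM
  have : S.comp (e : M.TripleTensor →L[𝕜] X) = T.comp (e : M.TripleTensor →L[𝕜] X) :=
    triple_hom_ext fun a x c => by
      simpa [he, exteriorMultiplication_triple] using h a x c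
  ext x
  simpa using DFunLike.congr_fun this (e.symm x)

/-- A balanced bounded trilinear map factors through the products `a.x.c` of an induced
bimodule. -/
theorem IsInduced.exists_lift [CompleteSpace G] (hM : M.IsInduced)
    (φ : A →L[𝕜] X →L[𝕜] A →L[𝕜] G)
    (h₁ : ∀ a b x c, φ (a * b) x c = φ a (M.left b x) c)
    (h₂ : ∀ a x b c, φ a (M.right b x) c = φ a x (b * c)) :
    ∃ T : X →L[𝕜] G, ∀ a x c, T (M.right c (M.left a x)) = φ a x c := by
  obtain ⟨e, he⟩ := hM
  obtain ⟨T, hT⟩ := M.exists_triple_lift φ h₁ h₂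
  refine ⟨T.comp (e.symm : X →L[𝕜] M.TripleTensor), fun a x c => ?_⟩
  rw [← hT, ← exteriorMultiplication_triple, ← he]
  simp

/-- The variant of `IsInduced.exists_lift` for a difference of two trilinear maps. -/
theorem IsInduced.exists_lift_sub [CompleteSpace G] (hM : M.IsInduced)
    (φ ψ : A →L[𝕜] X →L[𝕜] A →L[𝕜] G)
    (h₁ : ∀ a b x c, φ (a * b) x c - ψ (a * b) x c = φ a (M.left b x) c - ψ a (M.left b x) c)
    (h₂ : ∀ a x b c, φ a (M.right b x) c - ψ a (M.right b x) c = φ a x (b * c) - ψ a x (b * c)) :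
    ∃ T : X →L[𝕜] G, ∀ a x c, T (M.right c (M.left a x)) = φ a x c - ψ a x c :=
  hM.exists_lift (φ - ψ) h₁ h₂

end BanachBimodule

end Universal

/-! ### Trilinear maps behind the `B`-actions and the extended derivation -/

section Trilinear

variable {𝕜 : Type*} [RCLike 𝕜]
variable {A : Type*} [NormedAddCommGroup A] [NormedSpace 𝕜 A]
variable {B : Type*} [NormedAddCommGroup B] [NormedSpace 𝕜 B]
variable {X : Type*} [NormedAddCommGroup X] [NormedSpace 𝕜 X]
variable {Y : Type*} [NormedAddCommGroup Y] [NormedSpace 𝕜 Y]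
variable {G : Type*} [NormedAddCommGroup G] [NormedSpace 𝕜 G]

open ContinuousLinearMap

/-- The bounded trilinear map `(a, x, c) ↦ (b ↦ Q c (P (L b a) x))`. -/
def twistFirst (P : A →L[𝕜] X →L[𝕜] Y) (Q : A →L[𝕜] Y →L[𝕜] G) (L : B →L[𝕜] A →L[𝕜] A) :
    A →L[𝕜] X →L[𝕜] A →L[𝕜] B →L[𝕜] G :=
  (compL 𝕜 X (B →L[𝕜] Y) (A →L[𝕜] B →L[𝕜] G) ((compL 𝕜 B Y G).comp Q).flip).comp
    ((flipₗᵢ 𝕜 B X Y : (B →L[𝕜] X →L[𝕜] Y) →L[𝕜] X →L[𝕜] B →L[𝕜] Y).comp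
      ((compL 𝕜 B A (X →L[𝕜] Y) P).comp L.flip))

theorem twistFirst_apply (P : A →L[𝕜] X →L[𝕜] Y) (Q : A →L[𝕜] Y →L[𝕜] G)
    (L : B →L[𝕜] A →L[𝕜] A) (a : A) (x : X) (c : A) (b : B) :
    twistFirst P Q L a x c b = Q c (P (L b a) x) := rfl

/-- The bounded trilinear map `(a, x, c) ↦ (b ↦ Q (R b c) (P a x))`. -/
def twistLast (P : A →L[𝕜] X →L[𝕜] Y) (Q : A →L[𝕜] Y →L[𝕜] G) (R : B →L[𝕜] A →L[𝕜] A) :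
    A →L[𝕜] X →L[𝕜] A →L[𝕜] B →L[𝕜] G :=
  (compL 𝕜 X Y (A →L[𝕜] B →L[𝕜] G)
    ((flipₗᵢ 𝕜 A Y (B →L[𝕜] G) : _ →L[𝕜] Y →L[𝕜] A →L[𝕜] B →L[𝕜] G)
      ((flipₗᵢ 𝕜 B Y G : (B →L[𝕜] Y →L[𝕜] G) →L[𝕜] Y →L[𝕜] B →L[𝕜] G).comp
        ((compL 𝕜 B A (Y →L[𝕜] G) Q).comp R.flip)))).comp P

theorem twistLast_apply (P : A →L[𝕜] X →L[𝕜] Y) (Q : A →L[𝕜] Y →L[𝕜] G)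
    (R : B →L[𝕜] A →L[𝕜] A) (a : A) (x : X) (c : A) (b : B) :
    twistLast P Q R a x c b = Q (R b c) (P a x) := rfl

end Trilinear

/-! ### The actions of an envelope on its ideal -/

section EnvelopeActions

variable {𝕜 : Type*} [RCLike 𝕜]
variable {A : Type*} [NonUnitalNormedRing A] [NormedSpace 𝕜 A]
variable {B : Type*} [NonUnitalNormedRing B] [NormedSpace 𝕜 B] [IsScalarTower 𝕜 B B]
  [SMulCommClass 𝕜 B B]
variable {ι : A →ₙₐ[𝕜] B}

namespace IsEnvelope

/-- Injectivity of `ι` makes the element of `A` representing `b * ι a` unique, so the choice is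
automatically bilinear; the envelope inequality bounds it. -/
theorem exists_left (hι : IsEnvelope ι) :
    ∃ L : B →L[𝕜] A →L[𝕜] A, ∀ b a, ι (L b a) = b * ι a := by
  choose f hf using hι.ideal_left
  obtain ⟨C, -, hC⟩ := hι.bound
  refine ⟨LinearMap.mkContinuous₂ (LinearMap.mk₂ 𝕜 f ?_ ?_ ?_ ?_) C ?_, fun b a => hf b a⟩
  · intro b b' a; apply hι.injective; simp [hf, add_mul]
  · intro c b a; apply hι.injective; simp [hf, smul_mul_assoc]
  · intro b a a'; apply hι.injective; simp [hf, mul_add]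
  · intro c b a; apply hι.injective; simp [hf, mul_smul_comm]
  · intro b a
    have := hC a b (f b a) (.inl (hf b a))
    simpa [mul_right_comm] using this

theorem exists_right (hι : IsEnvelope ι) :
    ∃ R : B →L[𝕜] A →L[𝕜] A, ∀ b a, ι (R b a) = ι a * b := by
  choose f hf using fun (b : B) (a : A) => hι.ideal_right a b
  obtain ⟨C, -, hC⟩ := hι.bound
  refine ⟨LinearMap.mkContinuous₂ (LinearMap.mk₂ 𝕜 f ?_ ?_ ?_ ?_) C ?_, fun b a => hf b a⟩
  · intro b b' a; apply hι.injective; simp [hf, mul_add]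
  · intro c b a; apply hι.injective; simp [hf, mul_smul_comm]
  · intro b a a'; apply hι.injective; simp [hf, add_mul]
  · intro c b a; apply hι.injective; simp [hf, smul_mul_assoc]
  · intro b a
    have := hC a b (f b a) (.inr (hf b a))
    simpa [mul_right_comm] using this

end IsEnvelope

end EnvelopeActions

/-! ### Extending bimodules and derivations from `A` to `B` -/

section Extension

variable {𝕜 : Type*} [RCLike 𝕜]
variable {A : Type*} [NonUnitalNormedRing A] [NormedSpace 𝕜 A]
  [IsScalarTower 𝕜 A A] [SMulCommClass 𝕜 A A]
variable {B : Type*} [NonUnitalNormedRing B] [NormedSpace 𝕜 B]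
variable {X : Type*} [NormedAddCommGroup X] [NormedSpace 𝕜 X] [CompleteSpace X]
variable {ι : A →ₙₐ[𝕜] B} {M : BanachBimodule 𝕜 A X}

open ContinuousLinearMap in
/-- An induced bimodule over an ideal `A` is a bimodule over an envelope `B` of `A`, with
`b.(a.x.c) = (ba).x.c` and `(a.x.c).b = a.x.(cb)`. -/
theorem BanachBimodule.IsInduced.exists_envelope_bimodule (hM : M.IsInduced)
    (hι : IsEnvelope ι) {L R : B →L[𝕜] A →L[𝕜] A}
    (hL : ∀ b a, ι (L b a) = b * ι a) (hR : ∀ b a, ι (R b a) = ι a * b) :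
    ∃ N : BanachBimodule 𝕜 B X,
      (∀ b a x c, N.left b (M.right c (M.left a x)) = M.right c (M.left (L b a) x)) ∧
      (∀ b a x c, N.right b (M.right c (M.left a x)) = M.right (R b c) (M.left a x)) := by
  -- Associativity in `B`, pulled back along `ι`; these two identities make the trilinear maps below
  -- balanced.
  have L_mul : ∀ b a a', L b (a * a') = L b a * a' := fun b a a' => hι.injective (by
    simp [hL, mul_assoc])
  have R_mul : ∀ b a a', R b (a * a') = a * R b a' := fun b a a' => hι.injective (by
    simp [hR, mul_assoc])
  obtain ⟨S, hS⟩ := hM.exists_lift (twistFirst M.left M.right L)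
    (fun a b x c => by ext d; simp only [twistFirst_apply, L_mul, M.left_mul])
    (fun a x b c => by ext d; simp only [twistFirst_apply, M.left_right, M.right_mul])
  obtain ⟨T, hT⟩ := hM.exists_lift (twistLast M.left M.right R)
    (fun a b x c => by ext d; simp only [twistLast_apply, M.left_mul])
    (fun a x b c => by ext d; simp only [twistLast_apply, R_mul, M.left_right, M.right_mul])
  have hS' : ∀ b a x c, S.flip b (M.right c (M.left a x)) = M.right c (M.left (L b a) x) :=
    fun b a x c => by rw [flip_apply, hS, twistFirst_apply]
  have hT' : ∀ b a x c, T.flip b (M.right c (M.left a x)) = M.right (R b c) (M.left a x) :=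
    fun b a x c => by rw [flip_apply, hT, twistLast_apply]
  refine ⟨⟨S.flip, T.flip, fun b b' x => ?_, fun b b' x => ?_, fun b b' x => ?_⟩, hS', hT'⟩
  · have : S.flip (b * b') = (S.flip b).comp (S.flip b') := hM.hom_ext fun a x c => by
      have : L (b * b') a = L b (L b' a) := hι.injective (by simp [hL, mul_assoc])
      simp only [comp_apply, hS', this]
    exact DFunLike.congr_fun this x
  · have : T.flip (b * b') = (T.flip b').comp (T.flip b) := hM.hom_ext fun a x c => by
      have : R (b * b') c = R b' (R b c) := hι.injective (by simp [hR, mul_assoc])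
      simp only [comp_apply, hT', this]
    exact DFunLike.congr_fun this x
  · have : (S.flip b).comp (T.flip b') = (T.flip b').comp (S.flip b) :=
      hM.hom_ext fun a x c => by simp only [comp_apply, hS', hT']
    exact DFunLike.congr_fun this x

open ContinuousLinearMap in
/-- A derivation into the dual of an induced bimodule extends to every envelope. -/
theorem IsModuleDerivation.exists_extension (hM : M.IsInduced)
    (hι : IsEnvelope ι) {L R : B →L[𝕜] A →L[𝕜] A}
    (hL : ∀ b a, ι (L b a) = b * ι a) (hR : ∀ b a, ι (R b a) = ι a * b)
    {N : BanachBimodule 𝕜 B X}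
    (hNl : ∀ b a x c, N.left b (M.right c (M.left a x)) = M.right c (M.left (L b a) x))
    (hNr : ∀ b a x c, N.right b (M.right c (M.left a x)) = M.right (R b c) (M.left a x))
    {D : A →L[𝕜] StrongDual 𝕜 X} (hD : IsModuleDerivation M.dual D) :
    ∃ E : B →L[𝕜] StrongDual 𝕜 X, IsModuleDerivation N.dual E ∧ ∀ a, E (ι a) = D a := by
  have hD' : ∀ a b x, D (a * b) x = D b (M.right a x) + D a (M.left b x) := fun a b x =>
    DFunLike.congr_fun (hD a b) x
  have L_mul : ∀ b a a', L b (a * a') = L b a * a' := fun b a a' => hι.injective (by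
    simp [hL, mul_assoc])
  have R_mul : ∀ b a a', R b (a * a') = a * R b a' := fun b a a' => hι.injective (by
    simp [hR, mul_assoc])
  have R_mul_left : ∀ b a a', R b a * a' = a * L b a' := fun b a a' => hι.injective (by
    simp [hL, hR, mul_assoc])
  -- The formula forced by `c.E(b) = E(cb) - E(c).b`, evaluated at `a.x`.
  obtain ⟨T, hT⟩ := hM.exists_lift_sub (twistLast M.left D R) (twistFirst M.left D L)
    (fun a b x c => by
      ext d
      simp only [_root_.sub_apply, twistFirst_apply, twistLast_apply, L_mul, M.left_mul])
    -- Neither term is balanced here by itself. Expanding both by the Leibniz rule leaves the extra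
    -- terms `D(b)((cd)a.x)` and `D(b)(c(da).x)`, which cancel by `R_mul_left`.
    (fun a x b c => by
      ext d
      simp only [_root_.sub_apply, twistFirst_apply, twistLast_apply, R_mul, hD', M.left_right,
        ← M.left_mul, R_mul_left]
      ring)
  have hT' : ∀ b a x c, T.flip b (M.right c (M.left a x)) =
      D (R b c) (M.left a x) - D c (M.left (L b a) x) :=
    fun b a x c => by rw [flip_apply, hT, _root_.sub_apply, twistFirst_apply, twistLast_apply]
  refine ⟨T.flip, fun b b' => hM.hom_ext fun a x c => ?_, fun d => hM.hom_ext fun a x c => ?_⟩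
  -- On `a.x.c` both summands on the right contain `D(cb)(b'a.x)`, with opposite signs.
  · change _ = T.flip b' (N.right b _) + T.flip b (N.left b' _)
    have h₁ : R (b * b') c = R b' (R b c) := hι.injective (by simp [hR, mul_assoc])
    have h₂ : L (b * b') a = L b (L b' a) := hι.injective (by simp [hL, mul_assoc])
    rw [hNr, hNl, hT', hT', hT', h₁, h₂]
    ring
  · have h₁ : R (ι d) c = c * d := hι.injective (by simp [hR])
    have h₂ : L (ι d) a = d * a := hι.injective (by simp [hL])
    rw [hT', h₁, h₂, hD', M.left_mul]
    ring

/-- Approximate innerness into duals of induced bimodules is inherited from an envelope. -/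
theorem BanachBimodule.IsInduced.isApproximatelyInner [IsScalarTower 𝕜 B B]
    [SMulCommClass 𝕜 B B] {X : Type w} [NormedAddCommGroup X]
    [NormedSpace 𝕜 X] [CompleteSpace X] {M : BanachBimodule 𝕜 A X} (hM : M.IsInduced)
    (hι : IsEnvelope ι) (hB : ApproximatelyAmenable.{w} 𝕜 B)
    {D : A →L[𝕜] StrongDual 𝕜 X} (hD : IsModuleDerivation M.dual D) :
    IsApproximatelyInner M.dual D := by
  obtain ⟨L, hL⟩ := hι.exists_left
  obtain ⟨R, hR⟩ := hι.exists_right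
  obtain ⟨N, hNl, hNr⟩ := hM.exists_envelope_bimodule hι hL hR
  obtain ⟨E, hE, hED⟩ := hD.exists_extension hM hι hL hR hNl hNr
  -- The `B`-actions restrict along `ι` to the original `A`-actions, so restricting an inner
  -- derivation of `B` gives the inner derivation of `A` with the same functional.
  have hl : ∀ d, N.left (ι d) = M.left d := fun d => hM.hom_ext fun a x c => by
    have h : L (ι d) a = d * a := hι.injective (by simp [hL])
    rw [hNl, h, M.left_mul, M.left_right]
  have hr : ∀ d, N.right (ι d) = M.right d := fun d => hM.hom_ext fun a x c => by
    have h : R (ι d) c = c * d := hι.injective (by simp [hR])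
    rw [hNr, h, M.right_mul]
  have hcont : Continuous fun f : B → StrongDual 𝕜 X => f ∘ ι :=
    continuous_pi fun a => continuous_apply (ι a)
  have hcl := map_mem_closure hcont (hB X N E hE)
    (t := Set.range fun φ : StrongDual 𝕜 X => (innerDerivation M.dual φ : A → StrongDual 𝕜 X)) (by
      rintro _ ⟨φ, rfl⟩
      refine ⟨φ, ?_⟩
      ext a x
      change φ (M.right a x) - φ (M.left a x) = φ (N.right (ι a) x) - φ (N.left (ι a) x)
      rw [hl, hr])
  have : (E : B → StrongDual 𝕜 X) ∘ ι = D := funext hED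
  rwa [this] at hcl

end Extension

/-! ### Weak-star limits along ultrafilters -/

section WeakStar

open Filter

variable {𝕜 : Type*} [RCLike 𝕜]
variable {X : Type*} [NormedAddCommGroup X] [NormedSpace 𝕜 X]

/-- A bounded family of functionals converges pointwise along every ultrafilter. -/
theorem exists_pointwise_limit {α : Type*} (U : Ultrafilter α) (f : α → StrongDual 𝕜 X) (K : ℝ)
    (hf : ∀ᶠ i in U, ‖f i‖ ≤ K) :
    ∃ ψ : StrongDual 𝕜 X, (∀ x, Tendsto (fun i => f i x) U (𝓝 (ψ x))) ∧ ‖ψ‖ ≤ K := by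
  have hb : ∀ x, ∀ᶠ i in U, ‖f i x‖ ≤ K * ‖x‖ := fun x =>
    hf.mono fun i hi => (f i).le_of_opNorm_le hi x
  have hlim : ∀ x, ∃ c, Tendsto (fun i => f i x) U (𝓝 c) := fun x => by
    -- For each fixed `x` the values stay in a compact ball of scalars, where an ultrafilter
    -- converges.
    obtain ⟨c, -, hc⟩ := (isCompact_closedBall (0 : 𝕜) (K * ‖x‖)).ultrafilter_le_nhds
      (U.map fun i => f i x) (le_principal_iff.2 ((hb x).mono fun i hi => by simpa using hi))
    exact ⟨c, hc⟩
  choose g hg using hlim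
  have hgb : ∀ x, ‖g x‖ ≤ K * ‖x‖ := fun x => le_of_tendsto (hg x).norm (hb x)
  -- One index is kept only to know that `K` is nonnegative.
  obtain ⟨i, hi⟩ := hf.exists
  let ψ : X →ₗ[𝕜] 𝕜 :=
    { toFun := g
      map_add' := fun x y => tendsto_nhds_unique (hg (x + y)) (by
        simpa using (hg x).add (hg y))
      map_smul' := fun c x => tendsto_nhds_unique (hg (c • x)) (by
        simpa using (hg x).const_mul c) }
  exact ⟨ψ.mkContinuous K hgb, hg, ψ.mkContinuous_norm_le ((norm_nonneg _).trans hi) hgb⟩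

/-- The limit of the adjoints of the operators `S e` along an ultrafilter. -/
theorem exists_average {A : Type*} [NormedAddCommGroup A] [NormedSpace 𝕜 A]
    (U : Ultrafilter A) {C : ℝ} (hC : ∀ᶠ e in (U : Filter A), ‖e‖ ≤ C) (S : A →L[𝕜] X →L[𝕜] X) :
    ∃ Q : StrongDual 𝕜 X →L[𝕜] StrongDual 𝕜 X,
      ∀ φ x, Tendsto (fun e => φ (S e x)) U (𝓝 (Q φ x)) := by
  have hb : ∀ φ : StrongDual 𝕜 X,
      ∀ᶠ e in (U : Filter A), ‖φ.comp (S e)‖ ≤ ‖S‖ * C * ‖φ‖ := fun φ =>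
    hC.mono fun e he => by
      calc ‖φ.comp (S e)‖ ≤ ‖φ‖ * ‖S e‖ := φ.opNorm_comp_le _
        _ ≤ ‖φ‖ * (‖S‖ * C) := by gcongr; exact S.le_of_opNorm_le_of_le le_rfl he
        _ = ‖S‖ * C * ‖φ‖ := mul_comm _ _
  choose g hg hgb using fun φ : StrongDual 𝕜 X =>
    exists_pointwise_limit U (fun e => φ.comp (S e)) _ (hb φ)
  let Q : StrongDual 𝕜 X →ₗ[𝕜] StrongDual 𝕜 X :=
    { toFun := g
      map_add' := fun φ ψ => by
        ext x
        exact tendsto_nhds_unique (hg (φ + ψ) x) (by simpa using (hg φ x).add (hg ψ x))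
      map_smul' := fun c φ => by
        ext x
        exact tendsto_nhds_unique (hg (c • φ) x) (by simpa using (hg φ x).const_mul c) }
  exact ⟨Q.mkContinuous _ hgb, hg⟩

end WeakStar

/-! ### Derivations modulo inner ones, with a bounded approximate identity -/

section Derivations

open Filter

variable {𝕜 : Type*} [RCLike 𝕜]
variable {A : Type*} [NonUnitalNormedRing A] [NormedSpace 𝕜 A]
variable {X : Type*} [NormedAddCommGroup X] [NormedSpace 𝕜 X]
variable {M : BanachBimodule 𝕜 A X}

/-- Composition of a derivation with a bounded bimodule endomorphism. -/
theorem IsModuleDerivation.comp {D : A →L[𝕜] X} (hD : IsModuleDerivation M D) (T : X →L[𝕜] X)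
    (hl : ∀ a x, T (M.left a x) = M.left a (T x))
    (hr : ∀ a x, T (M.right a x) = M.right a (T x)) : IsModuleDerivation M (T.comp D) :=
  fun a b => by simp only [ContinuousLinearMap.comp_apply, hD a b, map_add, hl, hr]

/-- Adding an inner derivation preserves approximate innerness. -/
theorem IsApproximatelyInner.add_inner {D : A →L[𝕜] X} (hD : IsApproximatelyInner M D) (y : X) :
    IsApproximatelyInner M (D + innerDerivation M y) := by
  have hcont : Continuous fun f : A → X => f + (innerDerivation M y : A → X) :=
    continuous_id.add continuous_const
  have hcl := map_mem_closure hcont hD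
    (t := Set.range fun x : X => (innerDerivation M x : A → X)) (by
      rintro _ ⟨x, rfl⟩
      refine ⟨x + y, ?_⟩
      ext a
      simp only [innerDerivation, _root_.sub_apply, ContinuousLinearMap.flip_apply, map_add,
        Pi.add_apply, _root_.add_apply]
      abel)
  exact hcl

theorem innerDerivation_dual_apply (φ : StrongDual 𝕜 X) (a : A) (x : X) :
    innerDerivation M.dual φ a x = φ (M.right a x) - φ (M.left a x) := rfl

variable {U : Ultrafilter A} {C : ℝ}

/-- A derivation `E` into a dual module with `E(a).b = 0` is inner. -/
theorem IsModuleDerivation.exists_inner_of_right_eq_zero {E : A →L[𝕜] StrongDual 𝕜 X}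
    (hE : IsModuleDerivation M.dual E) (hC : ∀ᶠ e in (U : Filter A), ‖e‖ ≤ C)
    (hU : ∀ a, Tendsto (fun e => a * e) (U : Filter A) (𝓝 a))
    (h : ∀ a b x, E a (M.left b x) = 0) :
    ∃ ψ, E = innerDerivation M.dual ψ := by
  obtain ⟨ψ, hψ, -⟩ := exists_pointwise_limit U (fun e => E e) (‖E‖ * C)
    (hC.mono fun e he => E.le_of_opNorm_le_of_le le_rfl he)
  -- With `ψ` the weak-star limit of `E(e)`, the rule `E(ae) = a.E(e)` gives `E(a) = a.ψ`, while
  -- `ψ.a = 0`.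
  refine ⟨ψ, ?_⟩
  ext a x
  rw [innerDerivation_dual_apply]
  have h₀ : ψ (M.left a x) = 0 := tendsto_nhds_unique (hψ _) (by simp [h])
  have h₁ : Tendsto (fun e => E (a * e) x) U (𝓝 (E a x)) :=
    ((E.flip x).continuous.tendsto a).comp (hU a)
  have h₂ : ∀ e, E (a * e) x = E e (M.right a x) := fun e => by
    refine (DFunLike.congr_fun (hE a e) x).trans ?_
    change E e (M.right a x) + E a (M.left e x) = _
    rw [h, add_zero]
  rw [h₀, sub_zero]
  simp only [h₂] at h₁
  exact tendsto_nhds_unique h₁ (hψ _)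

/-- A derivation `E` into a dual module with `a.E(b) = 0` is inner. -/
theorem IsModuleDerivation.exists_inner_of_left_eq_zero {E : A →L[𝕜] StrongDual 𝕜 X}
    (hE : IsModuleDerivation M.dual E) (hC : ∀ᶠ e in (U : Filter A), ‖e‖ ≤ C)
    (hU : ∀ a, Tendsto (fun e => e * a) (U : Filter A) (𝓝 a))
    (h : ∀ a b x, E a (M.right b x) = 0) :
    ∃ ψ, E = innerDerivation M.dual ψ := by
  obtain ⟨ψ, hψ, -⟩ := exists_pointwise_limit U (fun e => E e) (‖E‖ * C)
    (hC.mono fun e he => E.le_of_opNorm_le_of_le le_rfl he)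
  -- Here `E(ea) = E(e).a` gives `E(a) = ψ.a` and `a.ψ = 0`, hence the sign.
  refine ⟨-ψ, ?_⟩
  ext a x
  rw [innerDerivation_dual_apply]
  have h₀ : ψ (M.right a x) = 0 := tendsto_nhds_unique (hψ _) (by simp [h])
  have h₁ : Tendsto (fun e => E (e * a) x) U (𝓝 (E a x)) :=
    ((E.flip x).continuous.tendsto a).comp (hU a)
  have h₂ : ∀ e, E (e * a) x = E e (M.left a x) := fun e => by
    refine (DFunLike.congr_fun (hE e a) x).trans ?_
    change E a (M.right e x) + E e (M.left a x) = _
    rw [h, zero_add]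
  simp only [h₂] at h₁
  simpa [h₀] using tendsto_nhds_unique h₁ (hψ _)

/-- With a bounded approximate identity, every derivation into a dual module is the sum of an
inner derivation and of `T ∘ D`, where `T` is a bounded bimodule endomorphism of `X*` such that
`T χ` depends, boundedly, only on the restriction of `χ` to any subspace containing all `a.x.c`. -/
theorem exists_endomorphism_of_isApproximateUnit (M : BanachBimodule 𝕜 A X)
    (hC : ∀ᶠ e in (U : Filter A), ‖e‖ ≤ C)
    (hUl : ∀ a, Tendsto (fun e => e * a) (U : Filter A) (𝓝 a))
    (hUr : ∀ a, Tendsto (fun e => a * e) (U : Filter A) (𝓝 a)) :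
    ∃ T : StrongDual 𝕜 X →L[𝕜] StrongDual 𝕜 X,
      (∀ a φ, T (M.dual.left a φ) = M.dual.left a (T φ)) ∧
      (∀ a φ, T (M.dual.right a φ) = M.dual.right a (T φ)) ∧
      (∃ K, 0 ≤ K ∧ ∀ S : Submodule 𝕜 X, (∀ a x c, M.right c (M.left a x) ∈ S) →
        ∀ χ : StrongDual 𝕜 X, ‖T χ‖ ≤ K * ‖χ.comp S.subtypeL‖) ∧
      ∀ D : A →L[𝕜] StrongDual 𝕜 X, IsModuleDerivation M.dual D →
        ∃ ψ, D = T.comp D + innerDerivation M.dual ψ := by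
  -- `Q φ` is the weak-star limit of `φ.e` and `R φ` that of `e.φ`.
  obtain ⟨Q, hQ⟩ := exists_average U hC M.left
  obtain ⟨R, hR⟩ := exists_average U hC M.right
  have hC0 : 0 ≤ C := by
    obtain ⟨e, he⟩ := hC.exists
    exact (norm_nonneg e).trans he
  have tl : ∀ {u : A → A} {a : A} (φ : StrongDual 𝕜 X) (x : X), Tendsto u U (𝓝 a) →
      Tendsto (fun e => φ (M.left (u e) x)) U (𝓝 (φ (M.left a x))) := fun φ x h =>
    ((φ.comp (M.left.flip x)).continuous.tendsto _).comp h
  have tr : ∀ {u : A → A} {a : A} (φ : StrongDual 𝕜 X) (x : X), Tendsto u U (𝓝 a) →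
      Tendsto (fun e => φ (M.right (u e) x)) U (𝓝 (φ (M.right a x))) := fun φ x h =>
    ((φ.comp (M.right.flip x)).continuous.tendsto _).comp h
  have Q_apply : ∀ φ a x, Q φ (M.left a x) = φ (M.left a x) := fun φ a x =>
    tendsto_nhds_unique (hQ φ _) (by simpa only [M.left_mul] using tl φ x (hUl a))
  have R_apply : ∀ φ a x, R φ (M.right a x) = φ (M.right a x) := fun φ a x =>
    tendsto_nhds_unique (hR φ _) (by simpa only [M.right_mul] using tr φ x (hUr a))
  have Ql : ∀ a φ, Q (M.dual.left a φ) = M.dual.left a (Q φ) := fun a φ => by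
    ext x
    refine tendsto_nhds_unique (hQ (M.dual.left a φ) x) ?_
    refine (hQ φ (M.right a x)).congr fun e => ?_
    rw [M.left_right]; rfl
  -- Both sides at `x` equal `φ(a.x)`: one because `ae → a`, the other because `ea → a`.
  have Qr : ∀ a φ, Q (M.dual.right a φ) = M.dual.right a (Q φ) := fun a φ => by
    ext x
    refine (tendsto_nhds_unique (hQ (M.dual.right a φ) x) ?_).trans (Q_apply φ a x).symm
    refine (tl φ x (hUr a)).congr fun e => ?_
    rw [M.left_mul]; rfl
  have Rr : ∀ a φ, R (M.dual.right a φ) = M.dual.right a (R φ) := fun a φ => by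
    ext x
    refine tendsto_nhds_unique (hR (M.dual.right a φ) x) ?_
    refine (hR φ (M.left a x)).congr fun e => ?_
    rw [← M.left_right]; rfl
  have Rl : ∀ a φ, R (M.dual.left a φ) = M.dual.left a (R φ) := fun a φ => by
    ext x
    refine (tendsto_nhds_unique (hR (M.dual.left a φ) x) ?_).trans (R_apply φ a x).symm
    refine (tr φ x (hUl a)).congr fun e => ?_
    rw [M.right_mul]; rfl
  -- `T φ (x)` is the iterated limit of `φ(e.x.f)`, so only values on the products `e.x.f` enter;
  -- this also gives the constant.
  refine ⟨R.comp Q, fun a φ => by simp [Ql, Rl], fun a φ => by simp [Qr, Rr],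
    ⟨‖M.left‖ * C * (‖M.right‖ * C), by positivity, fun S hS χ => ?_⟩, fun D hD => ?_⟩
  · refine ContinuousLinearMap.opNorm_le_bound _ (by positivity) fun x => ?_
    refine le_of_tendsto (hR (Q χ) x).norm (hC.mono fun f hf => ?_)
    refine le_of_tendsto (hQ χ (M.right f x)).norm (hC.mono fun e he => ?_)
    have hmem : M.left e (M.right f x) ∈ S := by rw [M.left_right]; exact hS e x f
    calc ‖χ (M.left e (M.right f x))‖
        = ‖χ.comp S.subtypeL ⟨_, hmem⟩‖ := rfl
      _ ≤ ‖χ.comp S.subtypeL‖ * ‖M.left e (M.right f x)‖ :=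
          (χ.comp S.subtypeL).le_opNorm ⟨_, hmem⟩
      _ ≤ ‖χ.comp S.subtypeL‖ * (‖M.left‖ * C * (‖M.right‖ * C * ‖x‖)) := by
          gcongr
          refine (M.left e).le_of_opNorm_le_of_le (M.left.le_of_opNorm_le_of_le le_rfl he) ?_
          exact (M.right f).le_of_opNorm_le_of_le (M.right.le_of_opNorm_le_of_le le_rfl hf) le_rfl
      _ = ‖M.left‖ * C * (‖M.right‖ * C) * ‖χ.comp S.subtypeL‖ * ‖x‖ := by ring
  · have hQD := hD.comp Q Ql Qr
    -- Split `D = (D - QD) + (QD - RQD) + RQD`. The first bracket takes values vanishing on `A.X`,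
    -- the second on `X.A`, so each is inner.
    obtain ⟨ψ₁, h₁⟩ := (hD.comp (ContinuousLinearMap.id 𝕜 _ - Q)
      (fun a φ => by simp [Ql]) (fun a φ => by simp [Qr])).exists_inner_of_right_eq_zero hC hUr
      (fun a b x => by simp [Q_apply])
    obtain ⟨ψ₂, h₂⟩ := (hQD.comp (ContinuousLinearMap.id 𝕜 _ - R)
      (fun a φ => by simp [Rl]) (fun a φ => by simp [Rr])).exists_inner_of_left_eq_zero hC hUl
      (fun a b x => by simp [R_apply])
    refine ⟨ψ₁ + ψ₂, ?_⟩
    have h₃ : innerDerivation M.dual (ψ₁ + ψ₂) =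
        innerDerivation M.dual ψ₁ + innerDerivation M.dual ψ₂ := by
      simp only [innerDerivation, map_add]; abel
    rw [h₃, ← h₁, ← h₂]
    ext a x
    simp

end Derivations

/-! ### Passing from an invariant subspace to the whole bimodule -/

section Restriction

variable {𝕜 : Type*} [RCLike 𝕜]
variable {A : Type*} [NonUnitalNormedRing A] [NormedSpace 𝕜 A]
variable {X : Type*} [NormedAddCommGroup X] [NormedSpace 𝕜 X]

/-- The restriction of a bounded action to an invariant subspace. -/
def restrictAction (P : A →L[𝕜] X →L[𝕜] X) (S : Submodule 𝕜 X) (h : ∀ a, ∀ x ∈ S, P a x ∈ S) :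
    A →L[𝕜] S →L[𝕜] S :=
  LinearMap.mkContinuous₂
    (LinearMap.mk₂ 𝕜 (fun a x => (⟨P a x, h a x x.2⟩ : S))
      (fun a b x => Subtype.ext (by simp)) (fun c a x => Subtype.ext (by simp))
      (fun a x y => Subtype.ext (by simp)) (fun c a x => Subtype.ext (by simp)))
    ‖P‖ (fun a x => P.le_opNorm₂ a x)

/-- The restriction of a bimodule to an invariant subspace. -/
def BanachBimodule.restrict (M : BanachBimodule 𝕜 A X) (S : Submodule 𝕜 X)
    (hl : ∀ a, ∀ x ∈ S, M.left a x ∈ S) (hr : ∀ a, ∀ x ∈ S, M.right a x ∈ S) :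
    BanachBimodule 𝕜 A S where
  left := restrictAction M.left S hl
  right := restrictAction M.right S hr
  left_mul a b x := Subtype.ext (M.left_mul a b x)
  right_mul a b x := Subtype.ext (M.right_mul a b x)
  left_right a b x := Subtype.ext (M.left_right a b x)

/-- Approximate innerness of the restriction of `D` to an invariant subspace passes to `T ∘ D`,
when `T` is a bimodule endomorphism of `X*` controlled by restriction to that subspace. -/
theorem IsApproximatelyInner.comp_of_restrict {M : BanachBimodule 𝕜 A X} {S : Submodule 𝕜 X}
    (hl : ∀ a, ∀ x ∈ S, M.left a x ∈ S) (hr : ∀ a, ∀ x ∈ S, M.right a x ∈ S)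
    {T : StrongDual 𝕜 X →L[𝕜] StrongDual 𝕜 X}
    (hTl : ∀ a φ, T (M.dual.left a φ) = M.dual.left a (T φ))
    (hTr : ∀ a φ, T (M.dual.right a φ) = M.dual.right a (T φ))
    {K : ℝ} (hK0 : 0 ≤ K) (hK : ∀ χ : StrongDual 𝕜 X, ‖T χ‖ ≤ K * ‖χ.comp S.subtypeL‖)
    {D : A →L[𝕜] StrongDual 𝕜 X} {D₁ : A →L[𝕜] StrongDual 𝕜 S}
    (hD₁ : ∀ a, D₁ a = (D a).comp S.subtypeL)
    (h : IsApproximatelyInner (M.restrict S hl hr).dual D₁) :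
    IsApproximatelyInner M.dual (T.comp D) := by
  -- Hahn–Banach extensions need not depend linearly or continuously on `φ`. Applying `T` removes
  -- the dependence on the choice, so `J` is Lipschitz and `J` of a restriction of `χ` is `T χ`.
  choose ext hext using fun φ : StrongDual 𝕜 S => exists_extension_norm_eq S φ
  have hext' : ∀ φ, (ext φ).comp S.subtypeL = φ := fun φ => by
    ext x; exact (hext φ).1 x
  have hT : ∀ χ χ' : StrongDual 𝕜 X, ‖T χ - T χ'‖ ≤
      K * ‖χ.comp S.subtypeL - χ'.comp S.subtypeL‖ := fun χ χ' => by
    rw [← map_sub, ← ContinuousLinearMap.sub_comp]; exact hK _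
  let J : StrongDual 𝕜 S → StrongDual 𝕜 X := fun φ => T (ext φ)
  have hJ : Continuous J := by
    refine (LipschitzWith.of_dist_le_mul (K := ⟨K, hK0⟩) fun φ φ' => ?_).continuous
    rw [dist_eq_norm, dist_eq_norm]
    have := hT (ext φ) (ext φ')
    rwa [hext', hext'] at this
  have hJT : ∀ χ : StrongDual 𝕜 X, J (χ.comp S.subtypeL) = T χ := fun χ => by
    have := hT (ext (χ.comp S.subtypeL)) χ
    rw [hext', sub_self, norm_zero, mul_zero] at this
    exact sub_eq_zero.1 (norm_le_zero_iff.1 this)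
  have hcont : Continuous fun f : A → StrongDual 𝕜 S => J ∘ f :=
    continuous_pi fun a => hJ.comp (continuous_apply a)
  have hcl := map_mem_closure hcont h
    (t := Set.range fun φ : StrongDual 𝕜 X => (innerDerivation M.dual φ : A → StrongDual 𝕜 X)) (by
      rintro _ ⟨φ, rfl⟩
      refine ⟨J φ, ?_⟩
      funext a
      have h₁ : innerDerivation (M.restrict S hl hr).dual φ a =
          (innerDerivation M.dual (ext φ) a).comp S.subtypeL := by
        rw [← hext' φ, hext']
        ext x
        exact congrArg₂ (· - ·) ((hext φ).1 _).symm ((hext φ).1 _).symm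
      change innerDerivation M.dual (T (ext φ)) a =
        J (innerDerivation (M.restrict S hl hr).dual φ a)
      rw [h₁, hJT]
      simp only [innerDerivation, _root_.sub_apply, ContinuousLinearMap.flip_apply, map_sub,
        hTl, hTr])
  have : J ∘ (D₁ : A → StrongDual 𝕜 S) = T.comp D := funext fun a => by
    simp only [Function.comp_apply, hD₁, hJT, ContinuousLinearMap.comp_apply]
  rwa [this] at hcl

end Restriction

/-! ### Essential bimodules are induced -/

section Essential

open Filter

variable {𝕜 : Type*} [RCLike 𝕜]
variable {A : Type*} [NonUnitalNormedRing A] [NormedSpace 𝕜 A]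
variable {X : Type*} [NormedAddCommGroup X] [NormedSpace 𝕜 X]

theorem tendsto_clm_apply {Y : Type*} [NormedAddCommGroup Y] [NormedSpace 𝕜 Y] {α : Type*}
    {l : Filter α} {f : α → X →L[𝕜] Y} {g : α → X} {f₀ : X →L[𝕜] Y} {x₀ : X}
    (hf : Tendsto f l (𝓝 f₀)) (hg : Tendsto g l (𝓝 x₀)) :
    Tendsto (fun i => f i (g i)) l (𝓝 (f₀ x₀)) :=
  ((isBoundedBilinearMap_apply (𝕜 := 𝕜)).continuous.tendsto (f₀, x₀)).comp (hf.prodMk_nhds hg)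

namespace BanachBimodule

/-- The closed linear span of the products `a.x.c`. -/
def essentialPart (M : BanachBimodule 𝕜 A X) : Submodule 𝕜 X :=
  (Submodule.span 𝕜 {y | ∃ a x c, y = M.right c (M.left a x)}).topologicalClosure

theorem isClosed_essentialPart (M : BanachBimodule 𝕜 A X) :
    IsClosed (M.essentialPart : Set X) :=
  Submodule.isClosed_topologicalClosure _

theorem mem_essentialPart (M : BanachBimodule 𝕜 A X) (a : A) (x : X) (c : A) :
    M.right c (M.left a x) ∈ M.essentialPart :=
  Submodule.le_topologicalClosure _ (Submodule.subset_span ⟨a, x, c, rfl⟩)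

theorem essentialPart_le {M : BanachBimodule 𝕜 A X} {S : Submodule 𝕜 X}
    (hS : IsClosed (S : Set X)) (h : ∀ a x c, M.right c (M.left a x) ∈ S) :
    M.essentialPart ≤ S :=
  Submodule.topologicalClosure_minimal _
    (Submodule.span_le.2 (by rintro _ ⟨a, x, c, rfl⟩; exact h a x c)) hS

theorem left_mem_essentialPart (M : BanachBimodule 𝕜 A X) (a : A) :
    ∀ x ∈ M.essentialPart, M.left a x ∈ M.essentialPart :=
  essentialPart_le (S := M.essentialPart.comap (M.left a).toLinearMap)
    (M.isClosed_essentialPart.preimage (M.left a).continuous) fun b x c => by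
      change M.left a _ ∈ M.essentialPart
      rw [M.left_right, ← M.left_mul]
      exact M.mem_essentialPart _ _ _

theorem right_mem_essentialPart (M : BanachBimodule 𝕜 A X) (a : A) :
    ∀ x ∈ M.essentialPart, M.right a x ∈ M.essentialPart :=
  essentialPart_le (S := M.essentialPart.comap (M.right a).toLinearMap)
    (M.isClosed_essentialPart.preimage (M.right a).continuous) fun b x c => by
      change M.right a _ ∈ M.essentialPart
      rw [← M.right_mul]
      exact M.mem_essentialPart _ _ _

/-- The essential part of a bimodule, as a bimodule. -/
abbrev essential (M : BanachBimodule 𝕜 A X) : BanachBimodule 𝕜 A M.essentialPart :=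
  M.restrict M.essentialPart M.left_mem_essentialPart M.right_mem_essentialPart

/-- The approximants equal `e.(a.x.c).f`, so this recovers `a.x.c` from products of elements of the
essential part. -/
theorem tendsto_right_left (M : BanachBimodule 𝕜 A X) {l : Filter A} (hl : l.IsApproximateUnit)
    (a : A) (x : X) (c : A) :
    Tendsto (fun p : A × A => M.right (c * p.2) (M.left (p.1 * a) x)) (l ×ˢ l)
      (𝓝 (M.right c (M.left a x))) := by
  have h₁ : Tendsto (fun p : A × A => c * p.2) (l ×ˢ l) (𝓝 c) :=
    (hl.tendsto_mul_left c).comp tendsto_snd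
  have h₂ : Tendsto (fun p : A × A => p.1 * a) (l ×ˢ l) (𝓝 a) :=
    (hl.tendsto_mul_right a).comp tendsto_fst
  exact tendsto_clm_apply ((M.right.continuous.tendsto c).comp h₁)
    (((M.left.flip x).continuous.tendsto a).comp h₂)

/-- With an approximate identity, the essential part of a bimodule is an essential bimodule. -/
theorem essentialPart_essential (M : BanachBimodule 𝕜 A X) {l : Filter A}
    (hl : l.IsApproximateUnit) : M.essential.essentialPart = ⊤ := by
  have := hl.neBot
  refine eq_top_iff.2 fun y _ => ?_
  have key : M.essentialPart ≤
      (M.essential.essentialPart.map M.essentialPart.subtype).topologicalClosure :=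
    essentialPart_le (Submodule.isClosed_topologicalClosure _) fun a x c => by
      refine mem_closure_of_tendsto (M.tendsto_right_left hl a x c) (.of_forall fun p => ?_)
      refine ⟨_, M.essential.mem_essentialPart p.1 ⟨_, M.mem_essentialPart a x c⟩ p.2, ?_⟩
      change M.right p.2 (M.left p.1 (M.right c (M.left a x))) = _
      rw [M.left_right, ← M.left_mul, ← M.right_mul]
  have hy : y ∈ closure (M.essential.essentialPart : Set M.essentialPart) :=
    closure_subtype.2 (key y.2)
  rwa [M.essential.isClosed_essentialPart.closure_eq] at hy

variable [IsScalarTower 𝕜 A A] [SMulCommClass 𝕜 A A]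

/-- The elementary tensors span a dense subspace of `A ⊗̂_A X ⊗̂_A A`. -/
theorem topologicalClosure_span_triple (M : BanachBimodule 𝕜 A X) :
    (Submodule.span 𝕜 {u | ∃ a x c, u = M.triple a x c}).topologicalClosure = ⊤ := by
  set S := (Submodule.span 𝕜 {u | ∃ a x c, u = M.triple a x c}).topologicalClosure with hS
  have : IsClosed (S : Set M.TripleTensor) := Submodule.isClosed_topologicalClosure _
  -- The quotient map kills all elementary tensors, so it vanishes.
  have h0 : S.mkQL = 0 := triple_hom_ext fun a x c =>
    (Submodule.Quotient.mk_eq_zero S).2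
      (Submodule.le_topologicalClosure _ (Submodule.subset_span ⟨a, x, c, rfl⟩))
  exact eq_top_iff.2 fun u _ => (Submodule.Quotient.mk_eq_zero S).1 (DFunLike.congr_fun h0 u)

variable [CompleteSpace X]

/-- With a bounded approximate identity, exterior multiplication is bounded below. -/
theorem exists_norm_le_exteriorMultiplication (M : BanachBimodule 𝕜 A X) (hA : HasBAI A) :
    ∃ K : ℝ, 0 ≤ K ∧ ∀ u, ‖u‖ ≤ K * ‖M.exteriorMultiplication u‖ := by
  obtain ⟨l, hl, C, hC⟩ := hA
  have := hl.neBot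
  have hC0 : 0 ≤ C := by
    obtain ⟨e, he⟩ := hC.exists
    exact (norm_nonneg e).trans he
  let t₁ := BalancedTensor.tmul (selfBimodule 𝕜 A).right M.left
  let t₂ := BalancedTensor.tmul M.leftTensorRight (selfBimodule 𝕜 A).left
  have htriple : ∀ a x c, M.triple a x c = t₂ (t₁ a x) c := fun _ _ _ => rfl
  -- Balancing moves `a` to the left factor and `c` to the right one.
  have hmul : ∀ e a x c f, t₂ (t₁ e (M.right c (M.left a x))) f = t₂ (t₁ (e * a) x) (c * f) := by
    intro e a x c f
    rw [← M.left_right]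
    have h₁ : t₁ e (M.left a (M.right c x)) = t₁ (e * a) (M.right c x) :=
      (BalancedTensor.tmul_balanced (selfBimodule 𝕜 A).right M.left e a _).symm
    have h₂ : t₁ (e * a) (M.right c x) = M.leftTensorRight c (t₁ (e * a) x) :=
      (M.leftTensorRight_tmul c (e * a) x).symm
    rw [h₁, h₂]
    exact BalancedTensor.tmul_balanced M.leftTensorRight (selfBimodule 𝕜 A).left _ c f
  refine ⟨‖t₂‖ * (‖t₁‖ * C) * C, by positivity, fun u => ?_⟩
  have hclosed : IsClosed {u : M.TripleTensor |
      ‖u‖ ≤ ‖t₂‖ * (‖t₁‖ * C) * C * ‖M.exteriorMultiplication u‖} :=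
    isClosed_le continuous_norm (continuous_const.mul M.exteriorMultiplication.continuous.norm)
  have hu : u ∈ (Submodule.span 𝕜 {u | ∃ a x c, u = M.triple a x c}).topologicalClosure := by
    rw [topologicalClosure_span_triple]; trivial
  refine closure_minimal (fun v hv => ?_) hclosed hu
  -- The maps `y ↦ e ⊗ y ⊗ f` are uniformly bounded approximate left inverses of exterior
  -- multiplication.
  have hlim : Tendsto (fun p : A × A => t₂ (t₁ p.1 (M.exteriorMultiplication v)) p.2) (l ×ˢ l)
      (𝓝 v) := by
    induction hv using Submodule.span_induction with
    | mem v hv =>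
      obtain ⟨a, x, c, rfl⟩ := hv
      simp only [exteriorMultiplication_triple, hmul]
      rw [htriple]
      have h₁ : Tendsto (fun p : A × A => c * p.2) (l ×ˢ l) (𝓝 c) :=
        (hl.tendsto_mul_left c).comp tendsto_snd
      have h₂ : Tendsto (fun p : A × A => p.1 * a) (l ×ˢ l) (𝓝 a) :=
        (hl.tendsto_mul_right a).comp tendsto_fst
      exact tendsto_clm_apply (((t₂.comp (t₁.flip x)).continuous.tendsto a).comp h₂) h₁
    | zero => simp
    | add v w _ _ hv hw => simpa using hv.add hw
    | smul k v _ hv => simpa using hv.const_smul k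
  refine le_of_tendsto hlim.norm ?_
  filter_upwards [(tendsto_fst (f := l) (g := l)).eventually hC,
    (tendsto_snd (f := l) (g := l)).eventually hC] with p h₁ h₂
  calc ‖t₂ (t₁ p.1 (M.exteriorMultiplication v)) p.2‖
      ≤ ‖t₂‖ * (‖t₁‖ * C * ‖M.exteriorMultiplication v‖) * C := by
        refine ContinuousLinearMap.le_of_opNorm_le_of_le _ ?_ h₂
        refine ContinuousLinearMap.le_of_opNorm_le_of_le _ le_rfl ?_
        exact ContinuousLinearMap.le_of_opNorm_le _ (t₁.le_of_opNorm_le_of_le le_rfl h₁) _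
    _ = ‖t₂‖ * (‖t₁‖ * C) * C * ‖M.exteriorMultiplication v‖ := by ring

/-- Over a Banach algebra with a bounded approximate identity, essential Banach bimodules are
induced. -/
theorem isInduced_of_essentialPart_eq_top (M : BanachBimodule 𝕜 A X) (hA : HasBAI A)
    (hM : M.essentialPart = ⊤) : M.IsInduced := by
  obtain ⟨K, hK0, hK⟩ := M.exists_norm_le_exteriorMultiplication hA
  have hanti : AntilipschitzWith ⟨K, hK0⟩ M.exteriorMultiplication :=
    M.exteriorMultiplication.antilipschitz_of_bound hK
  have hker : M.exteriorMultiplication.ker = ⊥ :=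
    LinearMap.ker_eq_bot.2 hanti.injective
  -- Being bounded below on a complete space closes the range, which contains every `a.x.c`.
  have hclosed : IsClosed (M.exteriorMultiplication.range : Set X) :=
    hanti.isClosed_range M.exteriorMultiplication.uniformContinuous
  have hrange : M.exteriorMultiplication.range = ⊤ :=
    eq_top_iff.2 (hM ▸ essentialPart_le hclosed fun a x c =>
      ⟨M.triple a x c, M.exteriorMultiplication_triple a x c⟩)
  exact ⟨.ofBijective M.exteriorMultiplication hker hrange, fun u => rfl⟩

end BanachBimodule

end Essential

end

/-! ### The main theorem -/

theorem theorem2p3 {𝕜 : Type t} [RCLike 𝕜]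
    {A : Type u} [NonUnitalNormedRing A] [NormedSpace 𝕜 A] [IsScalarTower 𝕜 A A]
    [SMulCommClass 𝕜 A A] [CompleteSpace A]
    {B : Type v} [NonUnitalNormedRing B] [NormedSpace 𝕜 B] [IsScalarTower 𝕜 B B]
    [SMulCommClass 𝕜 B B] [CompleteSpace B]
    (ι : A →ₙₐ[𝕜] B) (hι : IsEnvelope ι) (hB : ApproximatelyAmenable.{w} 𝕜 B) :
    (∀ (X : Type w) [NormedAddCommGroup X] [NormedSpace 𝕜 X] [CompleteSpace X]
      (M : BanachBimodule 𝕜 A X), M.IsInduced →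
      ∀ D : A →L[𝕜] StrongDual 𝕜 X, IsModuleDerivation M.dual D →
        IsApproximatelyInner M.dual D) ∧
    (HasBAI A → ApproximatelyAmenable.{w} 𝕜 A) := by
  refine ⟨fun X _ _ _ M hM D hD => hM.isApproximatelyInner hι hB hD, fun hA X _ _ _ M D hD => ?_⟩
  have hind : ∀ [CompleteSpace M.essentialPart], M.essential.IsInduced :=
    M.essential.isInduced_of_essentialPart_eq_top hA
      (hA.elim fun _ h => M.essentialPart_essential h.1)
  have : CompleteSpace M.essentialPart := M.isClosed_essentialPart.completeSpace_coe
  obtain ⟨l, hl, C, hC⟩ := hA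
  have := hl.neBot
  have hU := Ultrafilter.of_le l
  obtain ⟨T, hTl, hTr, ⟨K, hK0, hK⟩, hT⟩ :=
    exists_endomorphism_of_isApproximateUnit (U := Ultrafilter.of l) M (hC.filter_mono hU)
      (fun a => (hl.tendsto_mul_right a).mono_left hU)
      (fun a => (hl.tendsto_mul_left a).mono_left hU)
  obtain ⟨ψ, hψ⟩ := hT D hD
  -- The restriction of `D` to the induced essential part, to which the first claim applies.
  let D₁ : A →L[𝕜] StrongDual 𝕜 M.essentialPart :=
    ((ContinuousLinearMap.compL 𝕜 M.essentialPart X 𝕜).flip M.essentialPart.subtypeL).comp D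
  have hD₁ : IsModuleDerivation M.essential.dual D₁ := fun a b => by
    ext x
    exact DFunLike.congr_fun (hD a b) (x : X)
  rw [hψ]
  exact ((hind.isApproximatelyInner hι hB hD₁).comp_of_restrict _ _ hTl hTr hK0
    (hK _ M.mem_essentialPart) fun _ => rfl).add_inner ψ
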